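/- Let $G=(V,E)$ be a finite simple connected undirected graph, let $u\neq v$ be two non-adjacent vertices of $G$, and let $G'=G+e$ be obtained by inserting the edge $e=uv$. Let $\Gamma$ be the set of spanning trees of $G$ and $\Gamma'_e$ the set of spanning trees of $G'$ that contain $e$. Let $R(e)$ be the effective resistance between $u$ and $v$ in $G'$ with unit resistors on the edges, i.e. $R(e)=x_u-x_v$ for any $x\in\mathbb{R}^V$ with $L_{G'}x=\mathbf{1}_u-\mathbf{1}_v$, where $L_{G'}$ is the Laplacian matrix of $G'$. A link-cut operation on $\tau\in\Gamma$ adds $e$ to $\tau$ and then removes an edge other than $e$ from the cycle so created. Let $\mathcal{B}$ be the bipartite graph between $\Gamma$ and $\Gamma'_e$ in which $\tau\in\Gamma$ and $\tau_e\in\Gamma'_e$ are adjacent iff $\tau_e$ arises from $\tau$ by a link-cut operation; $\mathcal{N}_{\mathcal B}(\tau)$ denotes the set of neighbours and $d(\cdot)$ the degree in $\mathcal{B}$, and $U(S)$ is the uniform distribution on a finite non-empty set $S$. Then $\Gamma$, $\Gamma'_e$ and all $\mathcal{N}_{\mathcal B}(\tau)$ ($\tau\in\Gamma$) are non-empty,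 $d(\tau_e)>0$ for all $\tau_e\in\Gamma'_e$, $0<R(e)<1$, and for every real-valued function $f$ of spanning trees of $G'$, $$\mathop{\mathbb{E}}_{\tau\sim U(\Gamma'_e)}[f(\tau)]=\frac{1-R(e)}{R(e)}\mathop{\mathbb{E}}_{\tau\sim U(\Gamma)}\left[\mathop{\mathbb{E}}_{\tau_e\sim U(\mathcal{N}_{\mathcal B}(\tau))}\left[f(\tau_e)\frac{d(\tau)}{d(\tau_e)}\right]\right].$$ That is, for a tree $\tau_e$ generated by drawing $\tau\sim U(\Gamma)$ and then $\tau_e\sim U(\mathcal{N}_{\mathcal B}(\tau))$, the reweighted value $\frac{1-R(e)}{R(e)}\frac{d(\tau)}{d(\tau_e)}f(\tau_e)$ is an unbiased estimate of the mean of $f$ over $U(\Gamma'_e)$. -/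

import Mathlib

open scoped BigOperators Matrix

namespace LinkCut

variable {V : Type*} [Fintype V]

open Classical in
/-- The finite set of all spanning trees of `G`, as subgraphs on the whole vertex set. -/
noncomputable def spanningTrees (G : SimpleGraph V) : Finset (SimpleGraph V) :=
  Finset.univ.filter fun T => T ≤ G ∧ T.IsTree

/-- The graph obtained from `G` by inserting the edge `uv`. -/
def insertEdge (G : SimpleGraph V) (u v : V) : SimpleGraph V := G ⊔ SimpleGraph.edge u v

open Classical in
/-- The spanning trees of the updated graph `G + uv` that contain the edge `uv`. -/
noncomputable def newSpanningTrees (G : SimpleGraph V) (u v : V) : Finset (SimpleGraph V) :=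
  (spanningTrees (insertEdge G u v)).filter fun T => s(u, v) ∈ T.edgeSet

/-- `T'` results from a link-cut operation on `T`: link the edge `uv`, then cut an edge `g`
other than `uv` of the cycle through `uv` created in `T + uv`. -/
def IsLinkCut (u v : V) (T T' : SimpleGraph V) : Prop :=
  ∃ c : (insertEdge T u v).Walk u u, c.IsCycle ∧ s(u, v) ∈ c.edges ∧
    ∃ g ∈ c.edges, g ≠ s(u, v) ∧ T' = (insertEdge T u v).deleteEdges {g}

theorem not_mem_new_of_mem_old {G : SimpleGraph V} {u v : V} (huv : ¬ G.Adj u v)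
    {T : SimpleGraph V} (hT : T ∈ spanningTrees G) : T ∉ newSpanningTrees G u v := by
  classical
  simp only [spanningTrees, newSpanningTrees, Finset.mem_filter, SimpleGraph.mem_edgeSet] at *
  exact fun h => huv (hT.2.1 h.2)

/-- The link-cut graph between the spanning trees of `G` and the spanning trees of `G + uv`
containing `uv`. Simple graphs on `V` outside these two sets are isolated vertices. -/
def linkCutGraph (G : SimpleGraph V) (u v : V) : SimpleGraph (SimpleGraph V) :=
  SimpleGraph.fromRel fun T T' =>
    T ∈ spanningTrees G ∧ T' ∈ newSpanningTrees G u v ∧ IsLinkCut u v T T'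

theorem linkCutGraph_isBipartiteWith {G : SimpleGraph V} {u v : V} (huv : ¬ G.Adj u v) :
    (linkCutGraph G u v).IsBipartiteWith (spanningTrees G : Set (SimpleGraph V))
      (newSpanningTrees G u v : Set (SimpleGraph V)) where
  disjoint := Set.disjoint_left.2 fun _ hT hT' => not_mem_new_of_mem_old huv hT hT'
  mem_of_adj := by
    rintro T T' ⟨-, h | h⟩
    · exact Or.inl ⟨h.1, h.2.1⟩
    · exact Or.inr ⟨h.2.1, h.1⟩

open Classical in
/-- The set of neighbours of `T` in the link-cut graph. -/
noncomputable def linkCutNeighbors (G : SimpleGraph V) (u v : V) (T : SimpleGraph V) :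
    Finset (SimpleGraph V) :=
  (linkCutGraph G u v).neighborFinset T

open Classical in
/-- The degree of `T` in the link-cut graph. -/
noncomputable def linkCutDegree (G : SimpleGraph V) (u v : V) (T : SimpleGraph V) : ℕ :=
  (linkCutGraph G u v).degree T

open Classical in
/-- `x` is a vector of potentials for a unit current entering at `u` and leaving at `v`, every
edge of `G` being a unit resistor. -/
def IsUnitPotential (G : SimpleGraph V) (u v : V) (x : V → ℝ) : Prop :=
  G.lapMatrix ℝ *ᵥ x = Pi.single u 1 - Pi.single v 1

open Classical in
/-- Effective resistance: the potential difference between `u` and `v` when a unit current enters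
at `u` and leaves at `v`. -/
noncomputable def effectiveResistance (G : SimpleGraph V) (u v : V) : ℝ :=
  if h : ∃ x, IsUnitPotential G u v x then h.choose u - h.choose v else 0

theorem exists_isUnitPotential {G : SimpleGraph V} (hG : G.Connected) (u v : V) :
    ∃ x, IsUnitPotential G u v x := by
  classical
  let A : Module.End ℝ (EuclideanSpace ℝ V) := Matrix.toEuclideanLin (G.lapMatrix ℝ)
  have hA : A.IsSymmetric := Matrix.isSymmetric_toEuclideanLin_iff.2 (G.isHermitian_lapMatrix ℝ)
  let b : EuclideanSpace ℝ V := WithLp.toLp 2 (Pi.single u 1 - Pi.single v 1)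
  have hb : b ∈ LinearMap.range A := by
    rw [← Submodule.orthogonal_orthogonal (LinearMap.range A), hA.orthogonal_range]
    rw [Submodule.mem_orthogonal]
    intro y hy
    have hy' : G.lapMatrix ℝ *ᵥ (WithLp.ofLp y) = 0 := congrArg WithLp.ofLp hy
    have := (G.lapMatrix_mulVec_eq_zero_iff_forall_reachable).1 hy' u v (hG.preconnected u v)
    simp [b, PiLp.inner_apply, sub_mul, Finset.sum_sub_distrib, this]
  obtain ⟨x, hx⟩ := hb
  exact ⟨WithLp.ofLp x, congrArg WithLp.ofLp hx⟩

/-- In a connected graph the effective resistance does not depend on the chosen potentials. -/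
theorem effectiveResistance_eq {G : SimpleGraph V} (hG : G.Connected) {u v : V} {x : V → ℝ}
    (hx : IsUnitPotential G u v x) : effectiveResistance G u v = x u - x v := by
  classical
  have h : ∃ x, IsUnitPotential G u v x := ⟨x, hx⟩
  have hc := h.choose_spec
  have h0 : G.lapMatrix ℝ *ᵥ (h.choose - x) = 0 := by
    unfold IsUnitPotential at hx hc
    rw [Matrix.mulVec_sub, sub_eq_zero]
    exact hc.trans hx.symm
  have := (G.lapMatrix_mulVec_eq_zero_iff_forall_reachable).1 h0 u v (hG.preconnected u v)
  simp only [Pi.sub_apply] at this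
  rw [effectiveResistance, dif_pos h]
  linarith

end LinkCut

namespace LinkCut

/-!
Cutting an edge `wy` of a spanning tree leaves a spanning forest with two components that separates
`w` from `y`, and inserting `wy` undoes this. Hence, with `K u w` the number of two-component
spanning forests joining `u` and `w`, the difference `K u w - K u y` along an edge is the sum over
the spanning trees `T` through `wy` of `1` or `-1`, according to whether `T - wy` joins or separates
`w` and `u`. In every tree exactly one edge at `w ≠ u` separates `w` from `u`, so the Laplacian of
`K u` at `w` is `∑ T, (deg T w - 2)`, plus twice the number of spanning trees if `w = u`. The sum
cancels in `K u - K v`, which is therefore a multiple of a unit potential, and the effective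
resistance across an edge is the proportion of spanning trees containing it (Kirchhoff). For
`G + uv` this says that `(1 - R) / R` is the number of old trees divided by the number of new ones.

The estimator is then a double count of the edges of the link-cut graph: averaging over the
neighbours of `T` cancels the degree of `T`, and the degree of `T'` is cancelled by summing over the
neighbours `T` of `T'`. Only the absence of isolated vertices is special to trees: the cut edge of
`T` may be any edge of its path from `u` to `v`, and conversely `T' - uv` is reconnected by an edge
of `G`.
-/

open Finset SimpleGraph

section TwoForests

variable {V : Type*} {F G T : SimpleGraph V} {a b u v w y z : V}

/-- A spanning forest with exactly two components: what is left of a spanning tree when one of its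
edges is cut. As a graph on all of `V`, it has each of its isolated vertices as a component. -/
structure IsTwoForest (F : SimpleGraph V) : Prop where
  isAcyclic : F.IsAcyclic
  card_connectedComponent : Nat.card F.ConnectedComponent = 2

theorem card_connectedComponent_eq_two_iff (hab : ¬ F.Reachable a b) :
    Nat.card F.ConnectedComponent = 2 ↔ ∀ z, F.Reachable a z ∨ F.Reachable b z := by
  have hne : F.connectedComponentMk b ≠ F.connectedComponentMk a := fun h =>
    hab (ConnectedComponent.exact h).symm
  rw [Nat.card_eq_two_iff' (F.connectedComponentMk a)]
  constructor
  · intro h z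
    refine or_iff_not_imp_left.2 fun haz => ?_
    exact ConnectedComponent.exact (h.unique hne fun hz => haz (ConnectedComponent.exact hz).symm)
  · refine fun h => ⟨F.connectedComponentMk b, hne, ConnectedComponent.ind fun z hz => ?_⟩
    refine ConnectedComponent.sound ((h z).resolve_left fun haz => ?_).symm
    exact hz (ConnectedComponent.sound haz.symm)

theorem insertEdge_adj (hne : u ≠ v) : (insertEdge G u v).Adj u v :=
  Or.inr ((edge_adj ..).2 ⟨Or.inl ⟨rfl, rfl⟩, hne⟩)

theorem insertEdge_le (hF : F ≤ G) (hwy : G.Adj w y) : insertEdge F w y ≤ G :=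
  sup_le hF ((edge_le_iff G).2 (Or.inr hwy))

theorem le_of_le_insertEdge (hT : T ≤ insertEdge G u v) (huv : ¬ T.Adj u v) : T ≤ G := by
  rw [← sdiff_edge T huv]
  exact sdiff_le_iff'.2 hT

theorem deleteEdges_insertEdge (huv : ¬ F.Adj u v) :
    (insertEdge F u v).deleteEdges {s(u, v)} = F := by
  rw [insertEdge, deleteEdges_sup, deleteEdges_edge (Set.mem_singleton _), sup_bot_eq,
    deleteEdges_eq_self, Set.disjoint_singleton_right]
  exact huv

theorem insertEdge_deleteEdges (huv : T.Adj u v) :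
    insertEdge (T.deleteEdges {s(u, v)}) u v = T :=
  sdiff_sup_cancel ((edge_le_iff T).2 (Or.inr huv))

namespace IsTwoForest

theorem reachable_iff_not_reachable (hF : IsTwoForest F) (hab : ¬ F.Reachable a b) (z : V) :
    F.Reachable z b ↔ ¬ F.Reachable z a := by
  refine ⟨fun hzb hza => hab (hza.symm.trans hzb), fun hza => ?_⟩
  have hz := (card_connectedComponent_eq_two_iff hab).1 hF.card_connectedComponent z
  exact (hz.resolve_left fun haz => hza haz.symm).symm

theorem isTree_insertEdge (hF : IsTwoForest F) (hab : ¬ F.Reachable a b) :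
    (insertEdge F a b).IsTree where
  connected := by
    have hadj : (insertEdge F a b).Adj a b := insertEdge_adj fun h => hab (h ▸ Reachable.refl a)
    refine (connected_iff_exists_forall_reachable _).2 ⟨a, fun z => ?_⟩
    have hz := (card_connectedComponent_eq_two_iff hab).1 hF.card_connectedComponent z
    exact hz.elim (·.mono le_sup_left) fun hbz => hadj.reachable.trans (hbz.mono le_sup_left)
  isAcyclic := hF.isAcyclic.sup_edge_of_not_reachable hab

end IsTwoForest

theorem reachable_deleteEdges_or (hz : G.Reachable w z) (y : V) :
    (G.deleteEdges {s(w, y)}).Reachable w z ∨ (G.deleteEdges {s(w, y)}).Reachable y z := by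
  let S : Set V :=
    {x | (G.deleteEdges {s(w, y)}).Reachable w x ∨ (G.deleteEdges {s(w, y)}).Reachable y x}
  have hw : w ∈ S := Or.inl (Reachable.refl w)
  have hy : y ∈ S := Or.inr (Reachable.refl y)
  by_contra hzS
  obtain ⟨p⟩ := hz
  obtain ⟨⟨⟨c, d⟩, hcd⟩, -, hc, hd⟩ := p.exists_boundary_dart S hw hzS
  have hne : s(c, d) ≠ s(w, y) := by
    intro h
    have hdwy : d ∈ s(w, y) := h ▸ Sym2.mem_mk_right c d
    rcases Sym2.mem_iff.1 hdwy with rfl | rfl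
    exacts [hd hw, hd hy]
  have hcd' : (G.deleteEdges {s(w, y)}).Adj c d := deleteEdges_adj.2 ⟨hcd, hne⟩
  exact hd (hc.imp (·.trans hcd'.reachable) (·.trans hcd'.reachable))

theorem not_reachable_deleteEdges (hT : T.IsAcyclic) (hwy : T.Adj w y) :
    ¬ (T.deleteEdges {s(w, y)}).Reachable w y :=
  isAcyclic_iff_forall_adj_isBridge.1 hT hwy

theorem isTwoForest_deleteEdges (hT : T.IsTree) (hwy : T.Adj w y) :
    IsTwoForest (T.deleteEdges {s(w, y)}) where
  isAcyclic := hT.isAcyclic.anti (deleteEdges_le _)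
  card_connectedComponent :=
    (card_connectedComponent_eq_two_iff (not_reachable_deleteEdges hT.isAcyclic hwy)).2
      fun z => reachable_deleteEdges_or (hT.connected w z) y

theorem existsUnique_adj_not_reachable (hT : T.IsTree) (hwz : w ≠ z) :
    ∃! y, T.Adj w y ∧ ¬ (T.deleteEdges {s(w, y)}).Reachable w z := by
  obtain ⟨p, hp⟩ := hT.connected.exists_isPath w z
  cases p with
  | nil => exact absurd rfl hwz
  | @cons _ y _ hwy p =>
    have hw : w ∉ p.support := ((Walk.cons_isPath_iff hwy p).1 hp).2
    have hyz (x : V) : (T.deleteEdges {s(w, x)}).Reachable y z :=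
      ⟨p.toDeleteEdge _ fun hx => hw (p.fst_mem_support_of_mem_edges hx)⟩
    refine ⟨y, ⟨hwy, fun hz => ?_⟩, fun x ⟨_, hx⟩ => ?_⟩
    · exact not_reachable_deleteEdges hT.isAcyclic hwy (hz.trans (hyz y).symm)
    · by_contra hne
      have hwy' : (T.deleteEdges {s(w, x)}).Adj w y :=
        deleteEdges_adj.2 ⟨hwy, fun h => hne (Sym2.congr_right.1 h).symm⟩
      exact hx (hwy'.reachable.trans (hyz x))

open Classical in
/-- The indicator that `a` and `b` lie in different components of `F`. -/
noncomputable def separation (F : SimpleGraph V) (a b : V) : ℕ :=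
  if F.Reachable a b then 0 else 1

theorem separation_of_reachable (hab : F.Reachable a b) : separation F a b = 0 :=
  if_pos hab

theorem separation_of_not_reachable (hab : ¬ F.Reachable a b) : separation F a b = 1 :=
  if_neg hab

theorem sum_neighborFinset_separation [DecidableEq V] [Fintype (T.neighborSet w)] (hT : T.IsTree)
    (u : V) :
    ∑ y ∈ T.neighborFinset w, separation (T.deleteEdges {s(w, y)}) w u =
      if w = u then 0 else 1 := by
  split_ifs with hwu
  · subst hwu
    exact sum_eq_zero fun y _ => separation_of_reachable (Reachable.refl w)
  · obtain ⟨y, ⟨hwy, hy⟩, hunique⟩ := existsUnique_adj_not_reachable hT hwu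
    rw [sum_eq_single_of_mem y ((mem_neighborFinset ..).2 hwy), separation_of_not_reachable hy]
    intro x hx hxy
    rw [mem_neighborFinset] at hx
    exact separation_of_reachable (not_not.1 fun h => hxy (hunique x ⟨hx, h⟩))

theorem isLinkCut_of_not_reachable_deleteEdges {e : Sym2 V} (hT : T.Reachable u v)
    (huv : ¬ T.Adj u v) (he : ¬ (T.deleteEdges {e}).Reachable u v) :
    IsLinkCut u v T (insertEdge (T.deleteEdges {e}) u v) := by
  have hne : u ≠ v := fun h => he (h ▸ Reachable.refl u)
  have hle : T ≤ insertEdge T u v := le_sup_left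
  obtain ⟨p, hp⟩ := hT.symm.exists_isPath
  have hep : e ∈ p.edges := p.mem_edges_of_not_reachable_deleteEdges fun h => he h.symm
  have huvp : s(u, v) ∉ p.edges := fun h => huv (p.edges_subset_edgeSet h)
  have heuv : e ≠ s(u, v) := fun h => huvp (h ▸ hep)
  refine ⟨Walk.cons (insertEdge_adj hne) (p.mapLe hle), ?_, by simp, e, ?_, heuv, ?_⟩
  · rw [Walk.cons_isCycle_iff, Walk.edges_mapLe_eq_edges]
    exact ⟨hp.mapLe hle, huvp⟩
  · rw [Walk.edges_cons, Walk.edges_mapLe_eq_edges]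
    exact List.mem_cons_of_mem _ hep
  · have huve : (edge u v).deleteEdges {e} = edge u v := by
      rw [deleteEdges_eq_self, edgeSet_edge_of_ne hne, Set.disjoint_singleton]
      exact heuv.symm
    rw [insertEdge, insertEdge, deleteEdges_sup, huve]

end TwoForests

section EffectiveResistance

variable {V : Type*} [Fintype V] {F G H T : SimpleGraph V} {a b u v w y : V}

theorem mem_spanningTrees : T ∈ spanningTrees G ↔ T ≤ G ∧ T.IsTree := by
  simp [spanningTrees]

theorem spanningTrees_nonempty (hG : G.Connected) : (spanningTrees G).Nonempty := by
  obtain ⟨T, hT⟩ := hG.exists_isTree_le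
  exact ⟨T, mem_spanningTrees.2 hT⟩

open Classical in
/-- The spanning forests of `H` with exactly two components. -/
noncomputable def twoForests (H : SimpleGraph V) : Finset (SimpleGraph V) :=
  {F | F ≤ H ∧ IsTwoForest F}

theorem mem_twoForests : F ∈ twoForests H ↔ F ≤ H ∧ IsTwoForest F := by
  simp [twoForests]

open Classical in
theorem sum_twoForests_not_reachable {M : Type*} [AddCommMonoid M] (hwy : H.Adj w y)
    (g : SimpleGraph V → M) :
    ∑ F ∈ twoForests H with ¬ F.Reachable w y, g F =
      ∑ T ∈ spanningTrees H with T.Adj w y, g (T.deleteEdges {s(w, y)}) := by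
  symm
  refine sum_nbij' (fun T => T.deleteEdges {s(w, y)}) (fun F => insertEdge F w y)
    ?_ ?_ ?_ ?_ fun _ _ => rfl <;> simp only [mem_filter, mem_twoForests, mem_spanningTrees]
  · exact fun T ⟨⟨hle, hT⟩, hadj⟩ => ⟨⟨(deleteEdges_le _).trans hle,
      isTwoForest_deleteEdges hT hadj⟩, not_reachable_deleteEdges hT.isAcyclic hadj⟩
  · exact fun F ⟨⟨hle, hF⟩, hsep⟩ => ⟨⟨insertEdge_le hle hwy, hF.isTree_insertEdge hsep⟩,
      insertEdge_adj hwy.ne⟩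
  · exact fun T ⟨_, hadj⟩ => insertEdge_deleteEdges hadj
  · exact fun F ⟨_, hsep⟩ => deleteEdges_insertEdge fun hadj => hsep hadj.reachable

open Classical in
theorem card_twoForests_not_reachable (hwy : H.Adj w y) :
    #{F ∈ twoForests H | ¬ F.Reachable w y} = #{T ∈ spanningTrees H | T.Adj w y} := by
  rw [card_eq_sum_ones, card_eq_sum_ones, sum_twoForests_not_reachable hwy]

open Classical in
/-- The number of two-component spanning forests of `H` with `a` and `b` in the same component.
Up to a scalar factor, the difference of the functions `joiningCount H u` and `joiningCount H v` is
a potential for a current from `u` to `v`. -/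
noncomputable def joiningCount (H : SimpleGraph V) (a b : V) : ℕ :=
  #{F ∈ twoForests H | F.Reachable a b}

theorem joiningCount_comm (H : SimpleGraph V) (a b : V) :
    joiningCount H a b = joiningCount H b a := by
  classical
  exact congrArg card (filter_congr fun _ _ => reachable_comm)

theorem joiningCount_self (H : SimpleGraph V) (a : V) : joiningCount H a a = #(twoForests H) := by
  simp only [joiningCount, Reachable.refl, filter_true]

open Classical in
theorem joiningCount_add_card_not_reachable (H : SimpleGraph V) (a b : V) :
    joiningCount H a b + #{F ∈ twoForests H | ¬ F.Reachable a b} = #(twoForests H) :=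
  card_filter_add_card_filter_not _

open Classical in
theorem joiningCount_sub_joiningCount {R : Type*} [Ring R] (hwy : H.Adj w y) (u : V) :
    (joiningCount H u w - joiningCount H u y : R) =
      ∑ T ∈ spanningTrees H with T.Adj w y,
        (1 - 2 * (separation (T.deleteEdges {s(w, y)}) w u : R)) := by
  rw [← sum_twoForests_not_reachable hwy fun F => (1 - 2 * (separation F w u : R)),
    joiningCount, joiningCount, natCast_card_filter, natCast_card_filter, ← sum_sub_distrib,
    sum_filter]
  refine sum_congr rfl fun F hF => ?_
  by_cases hsep : F.Reachable w y
  · have hiff : F.Reachable u w ↔ F.Reachable u y := ⟨(·.trans hsep), (·.trans hsep.symm)⟩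
    simp only [hiff, hsep, sub_self, not_true_eq_false, if_false]
  · simp only [hsep, not_false_eq_true, if_true, separation, reachable_comm (u := w),
      (mem_twoForests.1 hF).2.reachable_iff_not_reachable hsep u]
    split_ifs <;> norm_num

theorem lapMatrix_mulVec_eq_sum_sub {R : Type*} [NonAssocRing R] (H : SimpleGraph V)
    [DecidableEq V] [DecidableRel H.Adj] (x : V → R) (w : V) :
    (H.lapMatrix R *ᵥ x) w = ∑ y ∈ H.neighborFinset w, (x w - x y) := by
  rw [lapMatrix_mulVec_apply, sum_sub_distrib, sum_const, card_neighborFinset_eq_degree,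
    nsmul_eq_mul]

open Classical in
/-- The first summand does not depend on `u`, so that it cancels between two sources. -/
theorem lapMatrix_mulVec_joiningCount (R : Type*) [Ring R] (H : SimpleGraph V) (u : V) :
    (H.lapMatrix R *ᵥ fun w => (joiningCount H u w : R)) =
      (fun w => ∑ T ∈ spanningTrees H, ((T.degree w : R) - 2)) +
        Pi.single u (2 * (#(spanningTrees H) : R)) := by
  funext w
  calc (H.lapMatrix R *ᵥ fun w => (joiningCount H u w : R)) w
      = ∑ y ∈ H.neighborFinset w, ∑ T ∈ spanningTrees H with T.Adj w y,
          (1 - 2 * (separation (T.deleteEdges {s(w, y)}) w u : R)) := by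
        rw [lapMatrix_mulVec_eq_sum_sub]
        exact sum_congr rfl fun y hy =>
          joiningCount_sub_joiningCount ((mem_neighborFinset ..).1 hy) u
    _ = ∑ T ∈ spanningTrees H, ∑ y ∈ T.neighborFinset w,
          (1 - 2 * (separation (T.deleteEdges {s(w, y)}) w u : R)) := by
        refine sum_comm' fun y T => ?_
        simp only [mem_filter, mem_neighborFinset]
        exact ⟨fun ⟨_, hT, hwy⟩ => ⟨hwy, hT⟩,
          fun ⟨hwy, hT⟩ => ⟨(mem_spanningTrees.1 hT).1 hwy, hT, hwy⟩⟩
    _ = ∑ T ∈ spanningTrees H, ((T.degree w : R) - 2 * ((if w = u then 0 else 1 : ℕ) : R)) := by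
        refine sum_congr rfl fun T hT => ?_
        rw [sum_sub_distrib, ← mul_sum, ← Nat.cast_sum,
          sum_neighborFinset_separation (mem_spanningTrees.1 hT).2, sum_const, nsmul_one,
          card_neighborFinset_eq_degree]
    _ = _ := by
        rw [Pi.add_apply, Pi.single_apply]
        split_ifs
        · simp [sum_sub_distrib, (Nat.cast_commute _ (2 : R)).eq]
        · simp

theorem isUnitPotential_joiningCount (hH : H.Connected) (u v : V) :
    IsUnitPotential H u v fun w =>
      ((joiningCount H u w : ℝ) - joiningCount H v w) / (2 * #(spanningTrees H)) := by
  classical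
  have hN : (#(spanningTrees H) : ℝ) ≠ 0 :=
    Nat.cast_ne_zero.2 (spanningTrees_nonempty hH).card_ne_zero
  have hx : (fun w => ((joiningCount H u w : ℝ) - joiningCount H v w) / (2 * #(spanningTrees H))) =
      (2 * #(spanningTrees H) : ℝ)⁻¹ •
        ((fun w => (joiningCount H u w : ℝ)) - fun w => (joiningCount H v w : ℝ)) := by
    funext w
    exact div_eq_inv_mul _ _
  rw [IsUnitPotential, hx, Matrix.mulVec_smul, Matrix.mulVec_sub, lapMatrix_mulVec_joiningCount,
    lapMatrix_mulVec_joiningCount, add_sub_add_left_eq_sub, smul_sub, ← Pi.single_smul,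
    ← Pi.single_smul, smul_eq_mul, inv_mul_cancel₀ (mul_ne_zero two_ne_zero hN)]

open Classical in
theorem effectiveResistance_eq_card_twoForests_div (hH : H.Connected) (u v : V) :
    effectiveResistance H u v =
      (#{F ∈ twoForests H | ¬ F.Reachable u v} : ℝ) / #(spanningTrees H) := by
  have hsplit : (joiningCount H u v : ℝ) + #{F ∈ twoForests H | ¬ F.Reachable u v} =
      #(twoForests H) := mod_cast joiningCount_add_card_not_reachable H u v
  rw [effectiveResistance_eq hH (isUnitPotential_joiningCount hH u v), ← sub_div,
    joiningCount_comm H v u, joiningCount_self, joiningCount_self, ← hsplit,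
    ← mul_div_mul_left _ _ (two_ne_zero' ℝ)]
  ring

open Classical in
theorem effectiveResistance_eq_of_adj (hH : H.Connected) (huv : H.Adj u v) :
    effectiveResistance H u v =
      (#{T ∈ spanningTrees H | T.Adj u v} : ℝ) / #(spanningTrees H) := by
  rw [effectiveResistance_eq_card_twoForests_div hH, card_twoForests_not_reachable huv]

open Classical in
theorem newSpanningTrees_eq_filter (G : SimpleGraph V) (u v : V) :
    newSpanningTrees G u v = {T ∈ spanningTrees (insertEdge G u v) | T.Adj u v} :=
  rfl

open Classical in
theorem spanningTrees_eq_filter_insertEdge (huv : ¬ G.Adj u v) :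
    spanningTrees G = {T ∈ spanningTrees (insertEdge G u v) | ¬ T.Adj u v} := by
  ext T
  simp only [mem_filter, mem_spanningTrees]
  exact ⟨fun ⟨hle, hT⟩ => ⟨⟨hle.trans le_sup_left, hT⟩, fun hadj => huv (hle hadj)⟩,
    fun ⟨⟨hle, hT⟩, hadj⟩ => ⟨le_of_le_insertEdge hle hadj, hT⟩⟩

theorem effectiveResistance_insertEdge (hG : G.Connected) (hne : u ≠ v) (huv : ¬ G.Adj u v) :
    effectiveResistance (insertEdge G u v) u v =
      (#(newSpanningTrees G u v) : ℝ) / (#(newSpanningTrees G u v) + #(spanningTrees G)) := by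
  have hconn : (insertEdge G u v).Connected := hG.mono le_sup_left
  rw [effectiveResistance_eq_of_adj hconn (insertEdge_adj hne),
    spanningTrees_eq_filter_insertEdge huv, newSpanningTrees_eq_filter, ← Nat.cast_add,
    card_filter_add_card_filter_not]

end EffectiveResistance

section LinkCutGraph

theorem sum_expect_neighborFinset {W K : Type*} [Semifield K] [CharZero K] {B : SimpleGraph W}
    [B.LocallyFinite] {s t : Finset W} (hB : B.IsBipartiteWith s t)
    (ht : ∀ b ∈ t, 0 < B.degree b) (f : W → K) :
    ∑ a ∈ s, 𝔼 b ∈ B.neighborFinset a, f b * ((B.degree a : K) / B.degree b) =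
      ∑ b ∈ t, f b := by
  have hexpect (a : W) : 𝔼 b ∈ B.neighborFinset a, f b * ((B.degree a : K) / B.degree b) =
      ∑ b ∈ B.neighborFinset a, f b / B.degree b := by
    rw [expect_eq_sum_div_card, sum_div]
    refine sum_congr rfl fun b hb => ?_
    have ha : (B.degree a : K) ≠ 0 := Nat.cast_ne_zero.2 (card_ne_zero_of_mem hb)
    rw [card_neighborFinset_eq_degree]
    field_simp
  calc ∑ a ∈ s, 𝔼 b ∈ B.neighborFinset a, f b * ((B.degree a : K) / B.degree b)
      = ∑ a ∈ s, ∑ b ∈ B.neighborFinset a, f b / B.degree b := sum_congr rfl fun a _ => hexpect a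
    _ = ∑ b ∈ t, ∑ _a ∈ B.neighborFinset b, f b / B.degree b := by
        refine sum_comm' fun a b => ?_
        simp only [mem_neighborFinset]
        exact ⟨fun ⟨ha, hab⟩ => ⟨hab.symm, hB.mem_of_mem_adj ha hab⟩,
          fun ⟨hba, hb⟩ => ⟨hB.symm.mem_of_mem_adj hb hba, hba.symm⟩⟩
    _ = ∑ b ∈ t, f b := by
        refine sum_congr rfl fun b hb => ?_
        rw [sum_const, card_neighborFinset_eq_degree, nsmul_eq_mul,
          mul_div_cancel₀ _ (Nat.cast_ne_zero.2 (ht b hb).ne')]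

variable {V : Type*} [Fintype V] {G T T' : SimpleGraph V} {u v : V}

theorem mem_newSpanningTrees :
    T ∈ newSpanningTrees G u v ↔ (T ≤ insertEdge G u v ∧ T.IsTree) ∧ T.Adj u v := by
  simp [newSpanningTrees, mem_spanningTrees]

theorem mem_linkCutNeighbors :
    T' ∈ linkCutNeighbors G u v T ↔ (linkCutGraph G u v).Adj T T' := by
  simp [linkCutNeighbors]

theorem linkCutGraph_adj (huv : ¬ G.Adj u v) (hT : T ∈ spanningTrees G)
    (hT' : T' ∈ newSpanningTrees G u v) (h : IsLinkCut u v T T') :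
    (linkCutGraph G u v).Adj T T' :=
  (fromRel_adj ..).2 ⟨fun hTT' => not_mem_new_of_mem_old huv hT (hTT' ▸ hT'), Or.inl ⟨hT, hT', h⟩⟩

theorem exists_adj_of_mem_spanningTrees (hne : u ≠ v) (huv : ¬ G.Adj u v)
    (hT : T ∈ spanningTrees G) : ∃ T', (linkCutGraph G u v).Adj T T' := by
  obtain ⟨hle, hTree⟩ := mem_spanningTrees.1 hT
  obtain ⟨y, ⟨hy, hsep⟩, -⟩ := existsUnique_adj_not_reachable hTree hne
  have hnew : insertEdge (T.deleteEdges {s(u, y)}) u v ∈ newSpanningTrees G u v :=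
    mem_newSpanningTrees.2 ⟨⟨sup_le_sup_right ((deleteEdges_le _).trans hle) _,
      (isTwoForest_deleteEdges hTree hy).isTree_insertEdge hsep⟩, insertEdge_adj hne⟩
  exact ⟨_, linkCutGraph_adj huv hT hnew (isLinkCut_of_not_reachable_deleteEdges
    (hTree.connected u v) (fun hadj => huv (hle hadj)) hsep)⟩

theorem exists_adj_of_mem_newSpanningTrees (hG : G.Connected) (huv : ¬ G.Adj u v)
    (hT' : T' ∈ newSpanningTrees G u v) : ∃ T, (linkCutGraph G u v).Adj T T' := by
  obtain ⟨⟨hle, hTree⟩, hadj⟩ := mem_newSpanningTrees.1 hT'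
  set F := T'.deleteEdges {s(u, v)}
  have hF2 : IsTwoForest F := isTwoForest_deleteEdges hTree hadj
  have hsep : ¬ F.Reachable u v := not_reachable_deleteEdges hTree.isAcyclic hadj
  have hFG : F ≤ G :=
    le_of_le_insertEdge ((deleteEdges_le _).trans hle) fun h => hsep h.reachable
  -- Some edge `wy` of `G` leads out of the component of `u` in `F`; it reconnects `F` inside `G`.
  obtain ⟨p⟩ := hG u v
  obtain ⟨⟨⟨w, y⟩, hwy⟩, -, huw, huy⟩ :=
    p.exists_boundary_dart {z | F.Reachable u z} (Reachable.refl u) hsep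
  have hsep' : ¬ F.Reachable w y := fun h => huy (huw.trans h)
  have hTG : insertEdge F w y ≤ G := insertEdge_le hFG hwy
  have hT : (insertEdge F w y).IsTree := hF2.isTree_insertEdge hsep'
  have hcut : (insertEdge F w y).deleteEdges {s(w, y)} = F :=
    deleteEdges_insertEdge fun h => hsep' h.reachable
  have hlink : insertEdge F u v = T' := insertEdge_deleteEdges hadj
  have hlc := isLinkCut_of_not_reachable_deleteEdges (e := s(w, y)) (hT.connected u v)
    (fun h => huv (hTG h)) (by rwa [hcut])
  rw [hcut, hlink] at hlc
  exact ⟨_, linkCutGraph_adj huv (mem_spanningTrees.2 ⟨hTG, hT⟩) hT' hlc⟩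

theorem linkCutNeighbors_nonempty (hne : u ≠ v) (huv : ¬ G.Adj u v)
    (hT : T ∈ spanningTrees G) : (linkCutNeighbors G u v T).Nonempty :=
  (exists_adj_of_mem_spanningTrees hne huv hT).imp fun _ => mem_linkCutNeighbors.2

theorem newSpanningTrees_nonempty (hG : G.Connected) (hne : u ≠ v) (huv : ¬ G.Adj u v) :
    (newSpanningTrees G u v).Nonempty := by
  obtain ⟨T, hT⟩ := spanningTrees_nonempty hG
  obtain ⟨T', hadj⟩ := exists_adj_of_mem_spanningTrees hne huv hT
  exact ⟨T', (linkCutGraph_isBipartiteWith huv).mem_of_mem_adj hT hadj⟩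

theorem linkCutDegree_pos (hG : G.Connected) (huv : ¬ G.Adj u v)
    (hT' : T' ∈ newSpanningTrees G u v) : 0 < linkCutDegree G u v T' := by
  obtain ⟨T, hadj⟩ := exists_adj_of_mem_newSpanningTrees hG huv hT'
  exact card_pos.2 ⟨T, mem_linkCutNeighbors.2 hadj.symm⟩

theorem sum_expect_linkCutNeighbors {K : Type*} [Semifield K] [CharZero K] (hG : G.Connected)
    (huv : ¬ G.Adj u v) (f : SimpleGraph V → K) :
    ∑ T ∈ spanningTrees G, 𝔼 T' ∈ linkCutNeighbors G u v T,
        f T' * ((linkCutDegree G u v T : K) / linkCutDegree G u v T') =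
      ∑ T' ∈ newSpanningTrees G u v, f T' := by
  classical
  exact sum_expect_neighborFinset (linkCutGraph_isBipartiteWith huv)
    (fun _ => linkCutDegree_pos hG huv) f

end LinkCutGraph

end LinkCut

theorem mainTheorem7 {V : Type*} [Fintype V] (G : SimpleGraph V) (hG : G.Connected)
    (u v : V) (hne : u ≠ v) (huv : ¬ G.Adj u v) (f : SimpleGraph V → ℝ) :
    (LinkCut.spanningTrees G).Nonempty ∧
    (LinkCut.newSpanningTrees G u v).Nonempty ∧
    (∀ T ∈ LinkCut.spanningTrees G, (LinkCut.linkCutNeighbors G u v T).Nonempty) ∧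
    (∀ T ∈ LinkCut.newSpanningTrees G u v, 0 < LinkCut.linkCutDegree G u v T) ∧
    0 < LinkCut.effectiveResistance (LinkCut.insertEdge G u v) u v ∧
    LinkCut.effectiveResistance (LinkCut.insertEdge G u v) u v < 1 ∧
    (𝔼 T ∈ LinkCut.newSpanningTrees G u v, f T) =
      (1 - LinkCut.effectiveResistance (LinkCut.insertEdge G u v) u v) /
          LinkCut.effectiveResistance (LinkCut.insertEdge G u v) u v *
        𝔼 T ∈ LinkCut.spanningTrees G,
          𝔼 T' ∈ LinkCut.linkCutNeighbors G u v T,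
            f T' * ((LinkCut.linkCutDegree G u v T : ℝ) /
              (LinkCut.linkCutDegree G u v T' : ℝ)) := by
  have hold : (0 : ℝ) < (LinkCut.spanningTrees G).card :=
    Nat.cast_pos.2 (LinkCut.spanningTrees_nonempty hG).card_pos
  have hnew : (0 : ℝ) < (LinkCut.newSpanningTrees G u v).card :=
    Nat.cast_pos.2 (LinkCut.newSpanningTrees_nonempty hG hne huv).card_pos
  refine ⟨LinkCut.spanningTrees_nonempty hG, LinkCut.newSpanningTrees_nonempty hG hne huv,
    fun T => LinkCut.linkCutNeighbors_nonempty hne huv,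
    fun T => LinkCut.linkCutDegree_pos hG huv, ?_⟩
  rw [Finset.expect_eq_sum_div_card, Finset.expect_eq_sum_div_card,
    LinkCut.sum_expect_linkCutNeighbors hG huv, LinkCut.effectiveResistance_insertEdge hG hne huv]
  refine ⟨by positivity, (div_lt_one (by positivity)).2 (by linarith), ?_⟩
  field_simp
  ring
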